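/- Let $q\in(0,1/2)$. For $A\subseteq\mathbb{C}$ put $$\Phi_q(A)=qA\,\cup\,\bigl(qA+(1-q)\bigr)\,\cup\,\bigl(qA+(1-q)\mathrm{i}\bigr)\,\cup\,\bigl(qA+(1-q)(1+\mathrm{i})\bigr).$$ Let $F_0=[0,1]\times[0,1]\subset\mathbb{C}$ and $F_k=\Phi_q(F_{k-1})$ for $k\ge 1$ (that is, $F_k=E_k\times E_k$ with $E_0=[0,1]$ and $E_k=qE_{k-1}\cup(qE_{k-1}+1-q)$), and let $F=\bigcap_{k=0}^{\infty}F_k$ be the generalized Cantor dust. The set $F_k$ consists of $4^k$ closed squares of side length $q^k$; the set $W_k$ of their centers is given by $W_0=\{(1+\mathrm{i})/2\}$ and $W_k=\Phi_q(W_{k-1})$ for $k\ge 1$. Let $$D_k=\bigcup_{w\in W_k}\Bigl\{z\in\mathbb{C}:|z-w|\le \tfrac{1}{\sqrt2}\,q^k\Bigr\},\qquad k\ge 0,$$ be the union of the closed disks circumscribing these squares. For a compact set $K\subset\mathbb{C}$ let $$\operatorname{cap}(K)=\sup_{\mu}\,\exp\Bigl(\iint\log|z-w|\,d\mu(z)\,d\mu(w)\Bigr)$$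 denote its logarithmic capacity, where $\mu$ runs over the Borel probability measures supported in $K$, and $\log 0=-\infty$, $\exp(-\infty)=0$. Theorem. For every $q\in(0,1/2)$, $$\bigcap_{k=0}^{\infty}D_k=F\qquad\text{and}\qquad \operatorname{cap}(F)=\lim_{k\to\infty}\operatorname{cap}(D_k).$$ -/

import Mathlib

open Filter Topology MeasureTheory
open scoped ENNReal

noncomputable section

/-- The energy `I(μ) = ∬ log |z - w| dμ(z) dμ(w)`, as an extended real number: the integral of
the positive part of `log |z - w|` minus the integral of its negative part. Here `ENNReal.log` is
the logarithm with `log 0 = -∞`. If `μ` is a probability measure with compact support, then the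
first integral is finite, so that the difference is meaningful and lies in `[-∞, ∞)`. -/
def logEnergy (μ : Measure ℂ) : EReal :=
  ((∫⁻ p : ℂ × ℂ, (ENNReal.log (edist p.1 p.2)).toENNReal ∂(μ.prod μ) : ℝ≥0∞) : EReal) -
    ((∫⁻ p : ℂ × ℂ, (-ENNReal.log (edist p.1 p.2)).toENNReal ∂(μ.prod μ) : ℝ≥0∞) : EReal)

/-- The logarithmic capacity `cap(E) = sup_μ exp(I(μ))`, where `μ` runs over the Borel probability
measures on the plane whose support is a compact subset of `E` (`exp(-∞) = 0`, and the supremum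
over no measures, for empty `E`, is `0`). It is finite for bounded `E`. -/
def logCapacity (E : Set ℂ) : ℝ≥0∞ :=
  ⨆ (μ : Measure ℂ) (_ : IsProbabilityMeasure μ)
    (_ : ∃ K : Set ℂ, IsCompact K ∧ K ⊆ E ∧ μ Kᶜ = 0), EReal.exp (logEnergy μ)

/-- `q A ∪ (q A + (1 - q)) ∪ (q A + (1 - q) i) ∪ (q A + (1 - q) (1 + i))`. -/
def dustStep (q : ℝ) (A : Set ℂ) : Set ℂ :=
  ((fun z : ℂ => q * z) '' A) ∪ ((fun z : ℂ => q * z + (1 - q)) '' A) ∪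
    ((fun z : ℂ => q * z + (1 - q) * Complex.I) '' A) ∪
    ((fun z : ℂ => q * z + (1 - q) * (1 + Complex.I)) '' A)

/-- The sets `F_k`, starting from the unit square `F_0 = [0,1] × [0,1]`. -/
def dustSquares (q : ℝ) : ℕ → Set ℂ
  | 0 => Set.Icc (0 : ℝ) 1 ×ℂ Set.Icc (0 : ℝ) 1
  | k + 1 => dustStep q (dustSquares q k)

/-- The generalized Cantor dust `F = ⋂ F_k`. -/
def cantorDust (q : ℝ) : Set ℂ := ⋂ k : ℕ, dustSquares q k

/-- The set of the centers `w_{k,1}, …, w_{k,4^k}` of the squares that make up `F_k`. -/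
def dustCenters (q : ℝ) : ℕ → Set ℂ
  | 0 => {(1 + Complex.I) / 2}
  | k + 1 => dustStep q (dustCenters q k)

/-- `D_k`, the union of the closed disks of radius `q ^ k / √2` around the centers. -/
def dustDisks (q : ℝ) (k : ℕ) : Set ℂ :=
  ⋃ w ∈ dustCenters q k, Metric.closedBall w (q ^ k / √2)

/-- The sets `E_k` of the generalized Cantor set on the real line. -/
def cantorStage (q : ℝ) : ℕ → Set ℝ
  | 0 => Set.Icc 0 1
  | k + 1 => ((fun x : ℝ => q * x) '' cantorStage q k) ∪
      ((fun x : ℝ => q * x + (1 - q)) '' cantorStage q k)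

/-- `F_k = E_k × E_k`. -/
theorem dustSquares_eq_reProdIm (q : ℝ) (k : ℕ) :
    dustSquares q k = cantorStage q k ×ℂ cantorStage q k := by
  induction k with
  | zero => rfl
  | succ k ih =>
    ext z
    simp only [dustSquares, dustStep, cantorStage, ih, Complex.mem_reProdIm, Set.mem_union,
      Set.mem_image]
    constructor
    · rintro (((⟨w, ⟨h1, h2⟩, rfl⟩ | ⟨w, ⟨h1, h2⟩, rfl⟩) | ⟨w, ⟨h1, h2⟩, rfl⟩) |
        ⟨w, ⟨h1, h2⟩, rfl⟩)
      · exact ⟨Or.inl ⟨_, h1, by simp⟩, Or.inl ⟨_, h2, by simp⟩⟩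
      · exact ⟨Or.inr ⟨_, h1, by simp⟩, Or.inl ⟨_, h2, by simp⟩⟩
      · exact ⟨Or.inl ⟨_, h1, by simp⟩, Or.inr ⟨_, h2, by simp⟩⟩
      · exact ⟨Or.inr ⟨_, h1, by simp⟩, Or.inr ⟨_, h2, by simp⟩⟩
    · rintro ⟨⟨x, hx, hx'⟩ | ⟨x, hx, hx'⟩, ⟨y, hy, hy'⟩ | ⟨y, hy, hy'⟩⟩
      · exact Or.inl (Or.inl (Or.inl ⟨⟨x, y⟩, ⟨hx, hy⟩, by apply Complex.ext <;> simp [← hx', ← hy']⟩))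
      · exact Or.inl (Or.inr ⟨⟨x, y⟩, ⟨hx, hy⟩, by apply Complex.ext <;> simp [← hx', ← hy']⟩)
      · exact Or.inl (Or.inl (Or.inr ⟨⟨x, y⟩, ⟨hx, hy⟩, by apply Complex.ext <;> simp [← hx', ← hy']⟩))
      · exact Or.inr ⟨⟨x, y⟩, ⟨hx, hy⟩, by apply Complex.ext <;> simp [← hx', ← hy']⟩

/-- `F_k` is the union of the closed squares of side length `q ^ k` around the centers. -/
theorem dustSquares_eq_iUnion (q : ℝ) (hq : 0 < q) (k : ℕ) : dustSquares q k =
    ⋃ w ∈ dustCenters q k, {z : ℂ | |z.re - w.re| ≤ q ^ k / 2 ∧ |z.im - w.im| ≤ q ^ k / 2} := by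
  induction k with
  | zero =>
    ext z
    simp [dustSquares, dustCenters, Complex.mem_reProdIm, abs_le]
    constructor
    · rintro ⟨⟨h1, h2⟩, h3, h4⟩
      refine ⟨⟨?_, ?_⟩, ?_, ?_⟩ <;> linarith
    · rintro ⟨⟨h1, h2⟩, h3, h4⟩
      refine ⟨⟨?_, ?_⟩, ?_, ?_⟩ <;> linarith
  | succ k ih =>
    have key (c : ℂ) : (fun z : ℂ => q * z + c) '' dustSquares q k =
      ⋃ w ∈ (fun z : ℂ => q * z + c) '' dustCenters q k,
        {z : ℂ | |z.re - w.re| ≤ q ^ (k+1) / 2 ∧ |z.im - w.im| ≤ q ^ (k+1) / 2} := by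
      have hm : ∀ t : ℝ, |q| * |t| ≤ q ^ (k+1) / 2 ↔ |t| ≤ q ^ k / 2 := by
        intro t
        rw [abs_of_pos hq, pow_succ', mul_div_assoc, mul_le_mul_iff_right₀ hq]
      rw [ih]
      ext z
      simp only [Set.mem_image, Set.mem_iUnion, Set.mem_ofPred_eq, exists_prop]
      constructor
      · rintro ⟨z, ⟨w, hw, h1, h2⟩, rfl⟩
        refine ⟨_, ⟨w, hw, rfl⟩, ?_, ?_⟩
        · simpa [← mul_sub, hm] using h1
        · simpa [← mul_sub, hm] using h2
      · rintro ⟨_, ⟨w, hw, rfl⟩, h1, h2⟩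
        have hq' : (q : ℂ) ≠ 0 := by exact_mod_cast hq.ne'
        obtain ⟨y, rfl⟩ : ∃ y : ℂ, q * y + c = z := ⟨(z - c) / q, by field_simp; ring⟩
        refine ⟨y, ⟨w, hw, ?_, ?_⟩, rfl⟩
        · simpa [← mul_sub, hm] using h1
        · simpa [← mul_sub, hm] using h2
    have k0 := key 0
    simp only [add_zero] at k0
    simp only [dustSquares, dustCenters, dustStep, Set.biUnion_union, key, k0]

end

open scoped NNReal

/-! The disks are compact, nested, and shrink to the dust: `dustDisks q k` contains `dustSquares q
k`, and its points are within `q ^ k / √2` of centers lying in those squares. The capacity claim is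
then continuity along decreasing compact sets (`tendsto_logCapacity_iInter`). Nearly optimal
measures on the stages have a weak limit by compactness; it is carried by every stage, hence by the
intersection, and its energy has not dropped, by `le_logEnergy_of_tendsto`: the kernel `-log |z -
w|` is a supremum of bounded continuous truncations. -/

/-- The probability measures carried by a fixed compact set form a compact set. -/
theorem isCompact_probabilityMeasure_compl_eq_zero {E : Type*} [MeasurableSpace E]
    [TopologicalSpace E] [T2Space E] [BorelSpace E] [NormalSpace E] {C : Set E}
    (hC : IsCompact C) :
    IsCompact {μ : ProbabilityMeasure E | (μ : Measure E) Cᶜ = 0} := by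
  have h := isCompact_setOfPred_probabilityMeasure_mass_eq_compl_isCompact_le (E := E)
    (u := fun _ => 0) (K := fun _ => C) tendsto_const_nhds (fun _ => hC) (Or.inl inferInstance)
  simpa [ProbabilityMeasure.null_iff_toMeasure_null] using h

theorem tendsto_lintegral_min_of_tendsto {X ι : Type*} [MeasurableSpace X] [TopologicalSpace X]
    [OpensMeasurableSpace X] {L : Filter ι} {μs : ι → ProbabilityMeasure X}
    {μ : ProbabilityMeasure X} (hμ : Tendsto μs L (𝓝 μ)) {g : X → ℝ≥0∞} (hg : Continuous g)
    (M : ℝ≥0) :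
    Tendsto (fun i => ∫⁻ x, min (g x) M ∂(μs i : Measure X)) L
      (𝓝 (∫⁻ x, min (g x) M ∂(μ : Measure X))) := by
  have hfin (x : X) : min (g x) M ≠ ∞ := ne_top_of_le_ne_top ENNReal.coe_ne_top (min_le_right _ _)
  have hle (x : X) : (min (g x) M).toNNReal ≤ M := by
    simpa using ENNReal.toNNReal_mono ENNReal.coe_ne_top (min_le_right (g x) (M : ℝ≥0∞))
  have hcont : Continuous fun x => (min (g x) (M : ℝ≥0∞)).toNNReal :=
    ENNReal.continuousOn_toNNReal.comp_continuous (hg.min continuous_const) hfin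
  let f : BoundedContinuousFunction X ℝ≥0 :=
    BoundedContinuousFunction.mkOfBound ⟨_, hcont⟩ M fun x y => by
      have hx : ((min (g x) (M : ℝ≥0∞)).toNNReal : ℝ) ≤ M := by exact_mod_cast hle x
      have hy : ((min (g y) (M : ℝ≥0∞)).toNNReal : ℝ) ≤ M := by exact_mod_cast hle y
      rw [NNReal.dist_eq, abs_le]
      constructor <;> simp only [ContinuousMap.coe_mk] <;>
        linarith [NNReal.coe_nonneg (min (g x) (M : ℝ≥0∞)).toNNReal,
          NNReal.coe_nonneg (min (g y) (M : ℝ≥0∞)).toNNReal]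
  have hf (x : X) : (f x : ℝ≥0∞) = min (g x) M := ENNReal.coe_toNNReal (hfin x)
  simpa only [hf] using ProbabilityMeasure.tendsto_iff_forall_lintegral_tendsto.mp hμ f

theorem lintegral_min_natCast_tendsto {X : Type*} [MeasurableSpace X] {μ : Measure X}
    {g : X → ℝ≥0∞} (hg : Measurable g) :
    Tendsto (fun n : ℕ => ∫⁻ x, min (g x) (n : ℝ≥0) ∂μ) atTop (𝓝 (∫⁻ x, g x ∂μ)) := by
  refine lintegral_tendsto_of_tendsto_of_monotone
    (fun n => (hg.min measurable_const).aemeasurable) ?_ ?_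
  · exact Eventually.of_forall fun x m n hmn => min_le_min_left _ (by exact_mod_cast hmn)
  · refine Eventually.of_forall fun x => ?_
    have : Tendsto (fun n : ℕ => min (g x) ((n : ℝ≥0) : ℝ≥0∞)) atTop (𝓝 (min (g x) ∞)) :=
      tendsto_const_nhds.min (by simpa using ENNReal.tendsto_nat_nhds_top)
    simpa using this

/-- The logarithmic energy is upper semicontinuous for weak convergence of probability measures
carried by a fixed compact set. -/
theorem le_logEnergy_of_tendsto {ι : Type*} {L : Filter ι} [L.NeBot] {C : Set ℂ}
    (hC : IsCompact C) {μs : ι → ProbabilityMeasure ℂ} {μ : ProbabilityMeasure ℂ}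
    (hμs : ∀ i, (μs i : Measure ℂ) Cᶜ = 0) (hμ : (μ : Measure ℂ) Cᶜ = 0)
    (hlim : Tendsto μs L (𝓝 μ)) {a : EReal} (ha : ∀ i, a ≤ logEnergy (μs i)) :
    a ≤ logEnergy μ := by
  have hprod : Tendsto (fun i => (μs i).prod (μs i)) L (𝓝 (μ.prod μ)) :=
    (ProbabilityMeasure.continuous_prod.tendsto (μ, μ)).comp (hlim.prodMk_nhds hlim)
  have hlog : Continuous fun p : ℂ × ℂ => ENNReal.log (edist p.1 p.2) :=
    ENNReal.continuous_log.comp (by fun_prop)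
  have hpos : Continuous fun p : ℂ × ℂ => (ENNReal.log (edist p.1 p.2)).toENNReal :=
    hlog.ereal_toENNReal
  have hneg : Continuous fun p : ℂ × ℂ => (-ENNReal.log (edist p.1 p.2)).toENNReal :=
    (continuous_neg.comp hlog).ereal_toENNReal
  -- The positive part is at most the logarithm of the diameter of `C`, so truncating it at `B`
  -- loses nothing. Only the negative part can be unbounded.
  obtain ⟨B, hB⟩ : ∃ B : ℝ≥0, ∀ ν : ProbabilityMeasure ℂ, (ν : Measure ℂ) Cᶜ = 0 →
      ∫⁻ p : ℂ × ℂ, (ENNReal.log (edist p.1 p.2)).toENNReal ∂((ν : Measure ℂ).prod ν) =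
        ∫⁻ p : ℂ × ℂ, min (ENNReal.log (edist p.1 p.2)).toENNReal B
          ∂((ν : Measure ℂ).prod ν) := by
    have htop : (ENNReal.log (Metric.ediam C)).toENNReal ≠ ∞ := by
      rw [EReal.toENNReal_ne_top_iff]
      exact (ENNReal.log_lt_top_iff.mpr (Metric.isBounded_iff_ediam_ne_top.mp hC.isBounded).lt_top).ne
    refine ⟨(ENNReal.log (Metric.ediam C)).toENNReal.toNNReal, fun ν hν => ?_⟩
    rw [ENNReal.coe_toNNReal htop]
    have h1 : ∀ᵐ p ∂((ν : Measure ℂ).prod (ν : Measure ℂ)), p.1 ∈ C :=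
      Measure.quasiMeasurePreserving_fst.ae (mem_ae_iff.mpr hν)
    have h2 : ∀ᵐ p ∂((ν : Measure ℂ).prod (ν : Measure ℂ)), p.2 ∈ C :=
      Measure.quasiMeasurePreserving_snd.ae (mem_ae_iff.mpr hν)
    refine lintegral_congr_ae ?_
    filter_upwards [h1, h2] with p hp1 hp2
    rw [min_eq_left]
    exact EReal.toENNReal_le_toENNReal
      (ENNReal.log_le_log (Metric.edist_le_ediam_of_mem hp1 hp2))
  have hfin (ν : ProbabilityMeasure ℂ) (M : ℝ≥0) (g : ℂ × ℂ → ℝ≥0∞) :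
      ∫⁻ p : ℂ × ℂ, min (g p) M ∂((ν : Measure ℂ).prod ν) ≠ ∞ := by
    refine ne_top_of_le_ne_top (b := (M : ℝ≥0∞)) ENNReal.coe_ne_top ?_
    calc ∫⁻ p : ℂ × ℂ, min (g p) M ∂((ν : Measure ℂ).prod ν)
        ≤ ∫⁻ _ : ℂ × ℂ, (M : ℝ≥0∞) ∂((ν : Measure ℂ).prod ν) :=
          lintegral_mono fun p => min_le_right _ _
      _ = M := by simp
  -- Written additively, the inequality survives the weak limit: the truncated integral is finite,
  -- so `EReal` addition is continuous there. Monotone convergence in `M` later removes the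
  -- truncation.
  have key (M : ℝ≥0) :
      a + ((∫⁻ p : ℂ × ℂ, min (-ENNReal.log (edist p.1 p.2)).toENNReal M
          ∂((μ : Measure ℂ).prod μ) : ℝ≥0∞) : EReal) ≤
        ((∫⁻ p : ℂ × ℂ, min (ENNReal.log (edist p.1 p.2)).toENNReal B
          ∂((μ : Measure ℂ).prod μ) : ℝ≥0∞) : EReal) := by
    have hN := (continuous_coe_ennreal_ereal.tendsto _).comp
      (tendsto_lintegral_min_of_tendsto hprod hneg M)
    have hP := (continuous_coe_ennreal_ereal.tendsto _).comp
      (tendsto_lintegral_min_of_tendsto hprod hpos B)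
    have hadd := (EReal.continuousAt_add (p := (a, _)) (Or.inr
      (EReal.coe_ennreal_ne_bot _)) (Or.inr (EReal.coe_ennreal_eq_top_iff.not.mpr (hfin μ M _)))).tendsto.comp
        ((tendsto_const_nhds (x := a)).prodMk_nhds hN)
    refine le_of_tendsto_of_tendsto' hadd hP fun i => ?_
    have hi := ha i
    rw [logEnergy, hB _ (hμs i)] at hi
    have hle := hi.trans (EReal.sub_le_sub le_rfl (EReal.coe_ennreal_le_coe_ennreal_iff.mpr
      (lintegral_mono fun p => min_le_left (-ENNReal.log (edist p.1 p.2)).toENNReal (M : ℝ≥0∞))))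
    exact (EReal.le_sub_iff_add_le (Or.inl (EReal.coe_ennreal_ne_bot _))
      (Or.inl (by simpa using hfin (μs i) M _))).mp hle
  rw [logEnergy, hB _ hμ]
  rcases eq_or_ne a ⊥ with rfl | hbot
  · exact bot_le
  have hP : ((∫⁻ p : ℂ × ℂ, min (ENNReal.log (edist p.1 p.2)).toENNReal B
      ∂((μ : Measure ℂ).prod μ) : ℝ≥0∞) : EReal) ≠ ⊤ := by simpa using hfin μ B _
  have hatop : a ≠ ⊤ := by
    rintro rfl
    have := key 0
    simp at this
    exact hP (by simpa using this)
  have hN : ((∫⁻ p : ℂ × ℂ, (-ENNReal.log (edist p.1 p.2)).toENNReal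
      ∂((μ : Measure ℂ).prod μ) : ℝ≥0∞) : EReal) ≤ _ :=
    le_of_tendsto' ((continuous_coe_ennreal_ereal.tendsto _).comp
      (lintegral_min_natCast_tendsto hneg.measurable)) fun n =>
        (EReal.le_sub_iff_add_le (Or.inl hbot) (Or.inl hatop)).mpr (by
          rw [add_comm]; exact key n)
  rw [EReal.le_sub_iff_add_le (Or.inl (EReal.coe_ennreal_ne_bot _)) (Or.inr hP), add_comm]
  exact (EReal.le_sub_iff_add_le (Or.inl hbot) (Or.inl hatop)).mp hN

theorem logCapacity_mono {A B : Set ℂ} (h : A ⊆ B) : logCapacity A ≤ logCapacity B := by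
  refine iSup_mono fun μ => iSup_mono fun _ => iSup_le fun ⟨K, hK, hKA, hμ⟩ => ?_
  exact le_iSup (fun _ : ∃ K : Set ℂ, IsCompact K ∧ K ⊆ B ∧ μ Kᶜ = 0 => EReal.exp (logEnergy μ))
    ⟨K, hK, hKA.trans h, hμ⟩

/-- The logarithmic capacity is continuous along decreasing sequences of compact sets. -/
theorem tendsto_logCapacity_iInter {K : ℕ → Set ℂ} (hK : ∀ n, IsCompact (K n))
    (hanti : Antitone K) :
    Tendsto (fun n => logCapacity (K n)) atTop (𝓝 (logCapacity (⋂ n, K n))) := by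
  have hmono : Antitone fun n => logCapacity (K n) := fun m n h => logCapacity_mono (hanti h)
  suffices h : ⨅ n, logCapacity (K n) = logCapacity (⋂ n, K n) from
    h ▸ tendsto_atTop_iInf hmono
  refine le_antisymm (le_of_forall_lt fun c hc => ?_)
    (le_iInf fun n => logCapacity_mono (Set.iInter_subset _ n))
  obtain ⟨d, hcd, hd⟩ := exists_between hc
  refine hcd.trans_le ?_
  have hex (n : ℕ) : ∃ μ : ProbabilityMeasure ℂ, (μ : Measure ℂ) (K n)ᶜ = 0 ∧
      ENNReal.log d ≤ logEnergy μ := by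
    have hn := hd.trans_le (iInf_le _ n)
    simp only [logCapacity, lt_iSup_iff] at hn
    obtain ⟨μ, hμ, ⟨C, -, hC, hμC⟩, hlt⟩ := hn
    refine ⟨⟨μ, hμ⟩, measure_mono_null (Set.compl_subset_compl.mpr hC) hμC, ?_⟩
    rw [← EReal.exp_le_exp_iff, ENNReal.exp_log]
    exact hlt.le
  choose μs hμs henergy using hex
  have hsupp {m n : ℕ} (h : m ≤ n) : (μs n : Measure ℂ) (K m)ᶜ = 0 :=
    measure_mono_null (Set.compl_subset_compl.mpr (hanti h)) (hμs n)
  -- An ultrafilter limit replaces a convergent subsequence. The hyperfilter contains every tail, so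
  -- the limit is carried by each `K n`.
  obtain ⟨μ, hμ, hlim⟩ :=
    (isCompact_probabilityMeasure_compl_eq_zero (hK 0)).ultrafilter_le_nhds'
      ((hyperfilter ℕ).map μs) (mem_map.mpr (Filter.univ_mem' fun n => hsupp n.zero_le))
  have hμK (n : ℕ) : (μ : Measure ℂ) (K n)ᶜ = 0 :=
    (isCompact_probabilityMeasure_compl_eq_zero (hK n)).isClosed.mem_of_tendsto hlim
      (((eventually_ge_atTop n).filter_mono Nat.hyperfilter_le_atTop).mono fun k hk => hsupp hk)
  have hE : ENNReal.log d ≤ logEnergy μ :=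
    le_logEnergy_of_tendsto (hK 0) (fun n => hsupp n.zero_le) hμ hlim henergy
  rw [← EReal.exp_le_exp_iff, ENNReal.exp_log] at hE
  refine hE.trans ?_
  refine le_iSup_of_le (μ : Measure ℂ) (le_iSup_of_le inferInstance (le_iSup_of_le
    ⟨⋂ n, K n, (hK 0).of_isClosed_subset (isClosed_iInter fun n => (hK n).isClosed)
      (Set.iInter_subset _ 0), subset_rfl, ?_⟩ le_rfl))
  rw [Set.compl_iInter]
  exact measure_iUnion_null hμK

/-! ### Geometry of the squares and disks -/

theorem dustStep_mono (q : ℝ) : Monotone (dustStep q) := fun _ _ h => by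
  unfold dustStep
  gcongr

theorem isCompact_dustSquares (q : ℝ) (k : ℕ) : IsCompact (dustSquares q k) := by
  induction k with
  | zero => exact isCompact_Icc.reProdIm isCompact_Icc
  | succ k ih =>
    exact (((ih.image (by fun_prop)).union (ih.image (by fun_prop))).union
      (ih.image (by fun_prop))).union (ih.image (by fun_prop))

theorem finite_dustCenters (q : ℝ) (k : ℕ) : (dustCenters q k).Finite := by
  induction k with
  | zero => exact Set.finite_singleton _
  | succ k ih => exact (((ih.image _).union (ih.image _)).union (ih.image _)).union (ih.image _)

theorem isCompact_dustDisks (q : ℝ) (k : ℕ) : IsCompact (dustDisks q k) :=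
  (finite_dustCenters q k).isCompact_biUnion fun _ _ => isCompact_closedBall _ _

theorem antitone_dustSquares {q : ℝ} (hq0 : 0 ≤ q) (hq1 : q ≤ 1) : Antitone (dustSquares q) := by
  refine antitone_nat_of_succ_le fun k => ?_
  induction k with
  | zero =>
    rintro z (((⟨w, hw, rfl⟩ | ⟨w, hw, rfl⟩) | ⟨w, hw, rfl⟩) | ⟨w, hw, rfl⟩) <;>
    · obtain ⟨⟨h1, h2⟩, h3, h4⟩ := hw
      simp only [dustSquares, Complex.mem_reProdIm, Set.mem_Icc]
      simp
      refine ⟨⟨?_, ?_⟩, ?_, ?_⟩ <;> nlinarith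
  | succ k ih => exact dustStep_mono q ih

theorem mem_dustStep_iff {q : ℝ} {A : Set ℂ} {z : ℂ} : z ∈ dustStep q A ↔
    ∃ c ∈ ({0, 1 - (q : ℂ), (1 - q) * Complex.I, (1 - q) * (1 + Complex.I)} : Set ℂ),
      ∃ w ∈ A, q * w + c = z := by
  simp [dustStep, or_assoc]

theorem norm_le_div_sqrt_two {z : ℂ} {r : ℝ} (hre : |z.re| ≤ r / 2) (him : |z.im| ≤ r / 2) :
    ‖z‖ ≤ r / √2 := by
  have hr : 0 ≤ r := by linarith [abs_nonneg z.re]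
  refine abs_le_of_sq_le_sq' ?_ (by positivity) |>.2
  rw [Complex.sq_norm, Complex.normSq_apply, div_pow, Real.sq_sqrt (by norm_num)]
  nlinarith [abs_le.mp hre, abs_le.mp him, sq_abs z.re, sq_abs z.im, abs_nonneg z.re,
    abs_nonneg z.im]

/-- At `k = 0` both coordinates of the displacement are `±(1 - q) / 2`. Applying one similarity to
both child and parent multiplies the distance by `q`. -/
theorem exists_dustCenters_dist_le {q : ℝ} (hq0 : 0 ≤ q) (hq1 : q ≤ 1) (k : ℕ) {w : ℂ}
    (hw : w ∈ dustCenters q (k + 1)) :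
    ∃ v ∈ dustCenters q k, dist w v ≤ q ^ k * ((1 - q) / √2) := by
  induction k generalizing w with
  | zero =>
    refine ⟨_, rfl, ?_⟩
    rw [pow_zero, one_mul, dist_eq_norm]
    obtain ⟨c, hc, u, rfl, rfl⟩ := mem_dustStep_iff.mp hw
    have h : |1 - q| = 1 - q := abs_of_nonneg (by linarith)
    apply norm_le_div_sqrt_two <;> rcases hc with rfl | rfl | rfl | rfl <;> rw [abs_le] <;>
      constructor <;> simp <;> linarith
  | succ k ih =>
    obtain ⟨c, hc, u, hu, rfl⟩ := mem_dustStep_iff.mp hw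
    obtain ⟨v, hv, hd⟩ := ih hu
    refine ⟨q * v + c, mem_dustStep_iff.mpr ⟨c, hc, v, hv, rfl⟩, ?_⟩
    rw [dist_add_right, dist_eq_norm, ← mul_sub, norm_mul, ← dist_eq_norm, Complex.norm_real,
      Real.norm_of_nonneg hq0, pow_succ', mul_assoc]
    gcongr

theorem antitone_dustDisks {q : ℝ} (hq0 : 0 ≤ q) (hq1 : q ≤ 1) : Antitone (dustDisks q) := by
  refine antitone_nat_of_succ_le fun k => Set.iUnion₂_subset fun w hw => ?_
  obtain ⟨v, hv, hd⟩ := exists_dustCenters_dist_le hq0 hq1 k hw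
  refine (Metric.closedBall_subset_closedBall' ?_).trans
    (Set.subset_biUnion_of_mem (u := fun w => Metric.closedBall w (q ^ k / √2)) hv)
  -- The child radius and the bound on the center displacement add up to exactly the parent radius.
  calc q ^ (k + 1) / √2 + dist w v ≤ q ^ (k + 1) / √2 + q ^ k * ((1 - q) / √2) := by gcongr
    _ = q ^ k / √2 := by ring

theorem dustSquares_subset_dustDisks {q : ℝ} (hq0 : 0 < q) (k : ℕ) :
    dustSquares q k ⊆ dustDisks q k := by
  rw [dustSquares_eq_iUnion q hq0]
  refine Set.iUnion₂_mono fun w _ z hz => ?_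
  rw [Metric.mem_closedBall, dist_eq_norm]
  exact norm_le_div_sqrt_two (by simpa using hz.1) (by simpa using hz.2)

theorem dustCenters_subset_dustSquares {q : ℝ} (hq0 : 0 < q) (k : ℕ) :
    dustCenters q k ⊆ dustSquares q k := by
  rw [dustSquares_eq_iUnion q hq0]
  refine fun w hw => Set.mem_biUnion hw ?_
  have : 0 ≤ q ^ k / 2 := by positivity
  simpa using this

theorem iInter_dustDisks {q : ℝ} (hq0 : 0 < q) (hq1 : q < 1) :
    ⋂ k : ℕ, dustDisks q k = cantorDust q := by
  refine Set.Subset.antisymm (fun z hz => Set.mem_iInter.mpr fun j => ?_)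
    (Set.iInter_mono fun k => dustSquares_subset_dustDisks hq0 k)
  have hex (k : ℕ) : ∃ w ∈ dustCenters q k, dist z w ≤ q ^ k / √2 := by
    simpa [dustDisks] using Set.mem_iInter.mp hz k
  choose w hw hd using hex
  have hlim : Tendsto w atTop (𝓝 z) := by
    rw [tendsto_iff_dist_tendsto_zero]
    refine squeeze_zero (fun _ => dist_nonneg) (fun k => (dist_comm _ _).trans_le (hd k)) ?_
    simpa using (tendsto_pow_atTop_nhds_zero_of_lt_one hq0.le hq1).div_const √2
  -- For `k ≥ j` the centers `w k` lie in the closed set `dustSquares q j`, and hence so does their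
  -- limit `z`.
  refine (isCompact_dustSquares q j).isClosed.mem_of_tendsto hlim ?_
  filter_upwards [eventually_ge_atTop j] with k hk
  exact antitone_dustSquares hq0.le hq1.le hk (dustCenters_subset_dustSquares hq0 k (hw k))

theorem theorem4p1 (q : ℝ) (hq0 : 0 < q) (hq : q < 1 / 2) :
    (⋂ k : ℕ, dustDisks q k) = cantorDust q ∧
      Tendsto (fun k : ℕ => logCapacity (dustDisks q k)) atTop (𝓝 (logCapacity (cantorDust q))) := by
  have hq1 : q < 1 := by linarith
  rw [← iInter_dustDisks hq0 hq1]
  exact ⟨rfl, tendsto_logCapacity_iInter (isCompact_dustDisks q) (antitone_dustDisks hq0.le hq1.le)⟩
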